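/- Let $p$ be a prime number, $d\ge 0$ an integer, $q=p^d$, and let $G$ be a profinite group. For a profinite group $K$ and $m\ge1$ let $H^i(K,\mathbb{Z}/m)$ be the continuous cohomology with trivial action of $K$ on $\mathbb{Z}/m$, and write $H^i(K)=H^i(K,\mathbb{Z}/q)$, so that $H^1(K)$ is the group of continuous homomorphisms $K\to\mathbb{Z}/q$. Let $\cup\colon H^1(K)\otimes_{\mathbb{Z}}H^1(K)\to H^2(K)$ be the homomorphism induced by the cup product, and let $\beta_K\colon H^1(K)\to H^2(K)$ be the Bockstein homomorphism, i.e. the connecting homomorphism of $0\to\mathbb{Z}/q\to\mathbb{Z}/q^2\to\mathbb{Z}/q\to0$. The descending $q$-central sequence of $G$ is defined by $G^{(1)}=G$ and $G^{(i+1)}=(G^{(i)})^q[G^{(i)},G]$, the closed subgroup of $G$ generated by all $h^q$ and all $[h,g]=h^{-1}g^{-1}hg$ with $h\in G^{(i)}$, $g\in G$. The group $G$ has *Galois relation type* if: (i) the kernel of $\cup\colon H^1(G)\otimes_{\mathbb{Z}}H^1(G)\to H^2(G)$ is generated by the elements of the form $\psi\otimes\psi'$, with $\psi,\psi'\in H^1(G)$,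 which it contains; (ii) there exists $\xi\in H^1(G)$ such that $\psi\cup\xi+\beta_G(\psi)=0$ for every $\psi\in H^1(G)$; and (iii) the natural map $H^1(G,\mathbb{Z}/q)\to H^1(G,\mathbb{Z}/p^i)$ is surjective for $1\le i\le d$. For a profinite group $K$, let $\Omega(K)=H^1(K)\otimes_{\mathbb{Z}}H^1(K)$ and $\Lambda_K(\alpha)=\cup\alpha$ if $q=2$; let $\Omega(K)=(H^1(K)\otimes_{\mathbb{Z}}H^1(K))\oplus H^1(K)$ and $\Lambda_K(\alpha_1,\alpha_2)=\cup\alpha_1+\beta_K(\alpha_2)$ if $q\ne2$. An element $\alpha\in\Omega(K)$ has *simple type and trivial kernel* if there are $\psi,\psi'\in H^1(K)$ with $\operatorname{Ker}(\psi)\cap\operatorname{Ker}(\psi')=1$ such that $\alpha=\psi\otimes\psi'$ (if $q=2$), respectively $\alpha=(\psi\otimes\psi',\psi)$ (if $q\neq2$). For an open normal subgroup $M$ of $G$ let $H^1(M)^G$ be the group of all $\varphi\in H^1(M)$ with $\varphi(g^{-1}mg)=\varphi(m)$ for all $g\in G$, $m\in M$, and let $\mathrm{trg}_{G/M}\colon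 H^1(M)^G\to H^2(G/M)$ be the transgression. A subgroup $N$ of $G$ is *distinguished* if there exist an open normal subgroup $M$ of $G$, an element $\varphi\in H^1(M)^G$, and an element $\bar\alpha\in\Omega(G/M)$ of simple type and trivial kernel, such that $\Lambda_{G/M}(\bar\alpha)=\mathrm{trg}_{G/M}(\varphi)$ and $N=\operatorname{Ker}(\varphi)$. Let $\Delta_G$ be the intersection of all distinguished subgroups of $G$. **Theorem.** If $G$ has Galois relation type, then $G^{(3)}=\Delta_G$. -/

import Mathlib

/-
Cohomology in degrees 1 and 2 of a topological group `G` with coefficients in the discrete trivial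
`G`-module `ℤ/n`, by continuous inhomogeneous cochains.  A map into a discrete space is continuous
exactly when it is locally constant, so continuity of cochains is expressed by `IsLocallyConstant`.
-/

open scoped TensorProduct

namespace QCentral

universe u

section Cohomology

variable (G : Type u) [Group G] [TopologicalSpace G]

/-- `H¹(G, ℤ/n) = Hom(G, ℤ/n)`: the continuous homomorphisms `G → ℤ/n`, as an additive group.
(The action is trivial, so these are the continuous 1-cocycles and every 1-coboundary is zero.) -/
def H1 (n : ℕ) : AddSubgroup (G → ZMod n) where
  carrier := {ψ | IsLocallyConstant ψ ∧ ∀ g h, ψ (g * h) = ψ g + ψ h}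
  zero_mem' := ⟨IsLocallyConstant.const 0, fun _ _ => by simp⟩
  add_mem' := by
    rintro a b ⟨ha, ha'⟩ ⟨hb, hb'⟩
    refine ⟨ha.add hb, fun g h => ?_⟩
    simp only [Pi.add_apply, ha', hb']
    ring
  neg_mem' := by
    rintro a ⟨ha, ha'⟩
    refine ⟨ha.neg, fun g h => ?_⟩
    simp only [Pi.neg_apply, ha']
    ring

/-- Continuous inhomogeneous 2-cocycles of `G` with values in the trivial module `ℤ/n`. -/
def Z2 (n : ℕ) : AddSubgroup (G × G → ZMod n) where
  carrier := {f | IsLocallyConstant f ∧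
    ∀ g h k, f (h, k) - f (g * h, k) + f (g, h * k) - f (g, h) = 0}
  zero_mem' := ⟨IsLocallyConstant.const 0, fun _ _ _ => by simp⟩
  add_mem' := by
    rintro a b ⟨ha, ha'⟩ ⟨hb, hb'⟩
    refine ⟨ha.add hb, fun g h k => ?_⟩
    simp only [Pi.add_apply]
    linear_combination ha' g h k + hb' g h k
  neg_mem' := by
    rintro a ⟨ha, ha'⟩
    refine ⟨ha.neg, fun g h k => ?_⟩
    simp only [Pi.neg_apply]
    linear_combination - ha' g h k

variable {G} in
/-- The coboundary `(∂c)(g, h) = c h - c (g h) + c g` of a 1-cochain `c`. -/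
def coboundary {n : ℕ} (c : G → ZMod n) : G × G → ZMod n :=
  fun x => c x.2 - c (x.1 * x.2) + c x.1

/-- 2-coboundaries: coboundaries of continuous 1-cochains. -/
def B2 (n : ℕ) : AddSubgroup (G × G → ZMod n) where
  carrier := {f | ∃ c : G → ZMod n, IsLocallyConstant c ∧ f = coboundary c}
  zero_mem' := ⟨0, IsLocallyConstant.const 0, by funext x; simp [coboundary]⟩
  add_mem' := by
    rintro _ _ ⟨a, ha, rfl⟩ ⟨b, hb, rfl⟩
    refine ⟨a + b, ha.add hb, ?_⟩
    funext x
    simp only [Pi.add_apply, coboundary]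
    ring
  neg_mem' := by
    rintro _ ⟨a, ha, rfl⟩
    refine ⟨-a, ha.neg, ?_⟩
    funext x
    simp only [Pi.neg_apply, coboundary]
    ring

/-- `H²(G, ℤ/n)`: continuous 2-cocycles modulo 2-coboundaries. -/
abbrev H2 (n : ℕ) : Type u := Z2 G n ⧸ (B2 G n).addSubgroupOf (Z2 G n)

variable {G}

/-- The cohomology class of a 2-cocycle. -/
def H2.mk {n : ℕ} (f : Z2 G n) : H2 G n := QuotientAddGroup.mk f

/-- The kernel of a class in `H¹(G, ℤ/n)`, a subgroup of `G`. -/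
def H1.ker {n : ℕ} (ψ : H1 G n) : Subgroup G where
  carrier := {g | ψ.1 g = 0}
  one_mem' := by
    have h := ψ.2.2 1 1
    simpa using h
  mul_mem' := by
    intro a b ha hb
    simp only [Set.mem_ofPred_eq] at *
    rw [ψ.2.2, ha, hb, add_zero]
  inv_mem' := by
    intro a ha
    have h1 : ψ.1 1 = 0 := by
      have h := ψ.2.2 1 1
      simpa using h
    have h := ψ.2.2 a a⁻¹
    simp only [Set.mem_ofPred_eq] at *
    rw [mul_inv_cancel, h1, ha, zero_add] at h
    exact h.symm

/-- The map `H¹(G, ℤ/n) → H¹(G, ℤ/m)` induced by the projection `ℤ/n → ℤ/m`, for `m ∣ n`. -/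
def H1.reduce {m n : ℕ} (hmn : m ∣ n) (ψ : H1 G n) : H1 G m :=
  ⟨fun g => ZMod.castHom hmn (ZMod m) (ψ.1 g),
    ψ.2.1.comp _, fun g h => by simp only [ψ.2.2, map_add]⟩

/-! ### Cup product -/

/-- The cocycle `(g, h) ↦ ψ(g) ψ'(h)` representing `ψ ∪ ψ'`. -/
def cupCocycle {n : ℕ} (ψ ψ' : H1 G n) : Z2 G n :=
  ⟨fun x => ψ.1 x.1 * ψ'.1 x.2,
    (ψ.2.1.comp_continuous continuous_fst).mul (ψ'.2.1.comp_continuous continuous_snd),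
    fun g h k => by
      simp only [ψ.2.2, ψ'.2.2]
      ring⟩

/-- The cup product `H¹(G, ℤ/n) × H¹(G, ℤ/n) → H²(G, ℤ/n)` as a biadditive map. -/
def cup {n : ℕ} : H1 G n →+ H1 G n →+ H2 G n :=
  AddMonoidHom.mk' (fun ψ => AddMonoidHom.mk' (fun ψ' => H2.mk (cupCocycle ψ ψ'))
    (fun a b => by
      unfold H2.mk
      rw [← QuotientAddGroup.mk_add]
      congr 1
      ext x
      simp [cupCocycle, mul_add]))
    (fun a b => by
      ext c
      simp only [AddMonoidHom.mk'_apply, AddMonoidHom.add_apply]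
      unfold H2.mk
      rw [← QuotientAddGroup.mk_add]
      congr 1
      ext x
      simp [cupCocycle, add_mul])

variable (G) in
/-- The homomorphism `H¹(G, ℤ/n) ⊗_ℤ H¹(G, ℤ/n) → H²(G, ℤ/n)` extending the cup product. -/
noncomputable def cupTensor (n : ℕ) : H1 G n ⊗[ℤ] H1 G n →+ H2 G n :=
  TensorProduct.liftAddHom cup (fun r a b => by simp)

/-! ### Bockstein homomorphism -/

/-- The integer `a(g) + a(h) - a(g h)`, where `a(g) ∈ {0, …, q - 1}` represents `ψ(g)`, divided
by `q`. -/
def carry {q : ℕ} (ψ : H1 G q) (x : G × G) : ℤ :=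
  (((ψ.1 x.1).val : ℤ) + ((ψ.1 x.2).val : ℤ) - ((ψ.1 (x.1 * x.2)).val : ℤ)) / (q : ℤ)

/-- The division in `carry` is exact. -/
theorem carry_spec {q : ℕ} [NeZero q] (ψ : H1 G q) (x : G × G) :
    (q : ℤ) * carry ψ x =
      ((ψ.1 x.1).val : ℤ) + ((ψ.1 x.2).val : ℤ) - ((ψ.1 (x.1 * x.2)).val : ℤ) := by
  apply Int.mul_ediv_cancel'
  rw [← ZMod.intCast_zmod_eq_zero_iff_dvd]
  push_cast
  simp only [ZMod.natCast_zmod_val, ψ.2.2]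
  ring

/-- The 2-cocycle representing the Bockstein of `ψ`: take the continuous cochain `G → ℤ/q²` that
lifts `ψ` with values in `{0, …, q - 1}`, form its coboundary and divide by `q`
(see `bocksteinCocycle_spec`). -/
def bocksteinCocycle {q : ℕ} [NeZero q] (ψ : H1 G q) : Z2 G q :=
  ⟨fun x => (carry ψ x : ZMod q), by
    have h : (fun x : G × G => (carry ψ x : ZMod q)) =
        (fun z : ZMod q × ZMod q =>
          (((((z.1).val : ℤ) + ((z.2).val : ℤ) - ((z.1 + z.2).val : ℤ)) / (q : ℤ) : ℤ) :
            ZMod q)) ∘ (fun x : G × G => (ψ.1 x.1, ψ.1 x.2)) := by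
      funext x
      simp only [carry, ψ.2.2, Function.comp]
    have h2 : IsLocallyConstant (fun x : G × G => (ψ.1 x.1, ψ.1 x.2)) :=
      (ψ.2.1.comp_continuous continuous_fst).prodMk (ψ.2.1.comp_continuous continuous_snd)
    rw [h]
    exact h2.comp _,
   fun g h k => by
    have hq : (q : ℤ) ≠ 0 := by exact_mod_cast NeZero.ne q
    have key : carry ψ (h, k) - carry ψ (g * h, k) + carry ψ (g, h * k) - carry ψ (g, h) = 0 := by
      apply mul_left_cancel₀ hq
      have e1 := carry_spec ψ (h, k)
      have e2 := carry_spec ψ (g * h, k)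
      have e3 := carry_spec ψ (g, h * k)
      have e4 := carry_spec ψ (g, h)
      simp only [mul_assoc] at e1 e2 e3 e4 ⊢
      linear_combination e1 - e2 + e3 - e4
    have key' := congrArg (Int.cast : ℤ → ZMod q) key
    push_cast at key'
    exact key'⟩

/-- `bocksteinCocycle ψ` is what the construction of the connecting map of
`0 → ℤ/q → ℤ/q² → ℤ/q → 0` yields: its image under the inclusion `ℤ/q → ℤ/q²`, `x ↦ q x`, is the
coboundary of a lift of `ψ`. -/
theorem bocksteinCocycle_spec {q : ℕ} [NeZero q] (ψ : H1 G q) (x : G × G) :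
    ((q : ZMod (q ^ 2)) * (((bocksteinCocycle ψ).1 x).val : ZMod (q ^ 2))) =
      coboundary (fun g => ((ψ.1 g).val : ZMod (q ^ 2))) x := by
  have h1 : (q : ℤ) ∣ (((bocksteinCocycle ψ).1 x).val : ℤ) - carry ψ x := by
    rw [← ZMod.intCast_zmod_eq_zero_iff_dvd]
    push_cast
    simp [bocksteinCocycle]
  obtain ⟨t, ht⟩ := h1
  have h2 : (q : ℤ) * (((bocksteinCocycle ψ).1 x).val : ℤ) =
      (((ψ.1 x.2).val : ℤ) - ((ψ.1 (x.1 * x.2)).val : ℤ) + ((ψ.1 x.1).val : ℤ)) +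
        ((q ^ 2 : ℕ) : ℤ) * t := by
    have e := carry_spec ψ x
    push_cast
    linear_combination (q : ℤ) * ht + e
  have h3 := congrArg (Int.cast : ℤ → ZMod (q ^ 2)) h2
  push_cast at h3
  rw [coboundary]
  have h4 : ((q : ZMod (q ^ 2)) ^ 2) = 0 := by
    have := ZMod.natCast_self (q ^ 2)
    push_cast at this
    exact this
  rw [h3, h4]
  ring

/-- The Bockstein map `β_G : H¹(G, ℤ/q) → H²(G, ℤ/q)`, the connecting map of
`0 → ℤ/q → ℤ/q² → ℤ/q → 0`. -/
def bockstein {q : ℕ} [NeZero q] (ψ : H1 G q) : H2 G q := H2.mk (bocksteinCocycle ψ)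

/-! ### Invariant classes and transgression -/

/-- `H¹(M)^G`, for a normal subgroup `M` of `G`: the continuous homomorphisms `φ : M → ℤ/n` with
`φ(g⁻¹ m g) = φ(m)` for all `g ∈ G` and `m ∈ M`. -/
def H1Inv (M : Subgroup G) [hN : M.Normal] (n : ℕ) : AddSubgroup (H1 M n) where
  carrier := {φ | ∀ (g : G) (m : M),
    φ.1 ⟨g⁻¹ * m * g, by simpa using hN.conj_mem m.1 m.2 g⁻¹⟩ = φ.1 m}
  zero_mem' := fun _ _ => rfl
  add_mem' := by
    intro a b ha hb g m
    exact congrArg₂ (· + ·) (ha g m) (hb g m)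
  neg_mem' := by
    intro a ha g m
    exact congrArg (fun z => -z) (ha g m)

/-- `c ∈ H²(G/M)` is the transgression of `φ ∈ H¹(M)^G`: there is a continuous cochain `y` on `G`
extending `φ` whose coboundary is the inflation of a cocycle on `G/M` representing `c`. -/
def IsTransgression {n : ℕ} (M : Subgroup G) [M.Normal] (φ : H1Inv M n) (c : H2 (G ⧸ M) n) :
    Prop :=
  ∃ (y : G → ZMod n) (f : Z2 (G ⧸ M) n), IsLocallyConstant y ∧
    (∀ m : M, y m = φ.1.1 m) ∧
    (∀ g h : G, f.1 ((g : G ⧸ M), (h : G ⧸ M)) = coboundary y (g, h)) ∧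
    H2.mk f = c

theorem isTransgression_unique {n : ℕ} [IsTopologicalGroup G] (M : Subgroup G) [M.Normal]
    (hM : IsOpen (M : Set G)) (φ : H1Inv M n) (c c' : H2 (G ⧸ M) n)
    (hc : IsTransgression M φ c) (hc' : IsTransgression M φ c') : c = c' := by
  obtain ⟨y, f, hy, hyM, hf, rfl⟩ := hc
  obtain ⟨y', f', hy', hyM', hf', rfl⟩ := hc'
  have : DiscreteTopology (G ⧸ M) := QuotientGroup.discreteTopology hM
  have hz1 : ∀ m : M, y m - y' m = 0 := fun m => by rw [hyM, hyM', sub_self]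
  have hconst : ∀ (g : G) (m : M), y (g * m) - y' (g * m) = y g - y' g := by
    intro g m
    have hm : ((m : G) : G ⧸ M) = ((1 : G) : G ⧸ M) := by
      rw [QuotientGroup.eq]
      simp
    have a1 := hf g m
    have a2 := hf g 1
    have b1 := hf' g m
    have b2 := hf' g 1
    rw [hm] at a1 b1
    simp only [coboundary, mul_one] at a1 a2 b1 b2
    have z1 := hz1 m
    have z2 := hz1 1
    simp only [Subgroup.coe_one] at z2
    linear_combination a1 - a2 - b1 + b2 + z1 - z2
  unfold H2.mk
  rw [QuotientAddGroup.eq, AddSubgroup.mem_addSubgroupOf]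
  refine ⟨Quotient.lift (s := QuotientGroup.leftRel M) (fun g => y' g - y g) ?_,
    IsLocallyConstant.of_discrete _, ?_⟩
  · intro a b hab
    have hab' : a⁻¹ * b ∈ M := QuotientGroup.leftRel_apply.mp hab
    have := hconst a ⟨a⁻¹ * b, hab'⟩
    simp only [mul_inv_cancel_left] at this
    linear_combination this
  · funext x
    obtain ⟨g, h⟩ := x
    induction g using QuotientGroup.induction_on with
    | H g =>
      induction h using QuotientGroup.induction_on with
      | H h =>
        have a := hf g h
        have b := hf' g h
        change - f.1 ((g : G ⧸ M), (h : G ⧸ M)) + f'.1 ((g : G ⧸ M), (h : G ⧸ M)) =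
          (y' h - y h) - (y' (g * h) - y (g * h)) + (y' g - y g)
        rw [a, b]
        simp only [coboundary]
        ring

theorem exists_isTransgression {n : ℕ} [IsTopologicalGroup G] (M : Subgroup G) [hN : M.Normal]
    (hM : IsOpen (M : Set G)) (φ : H1Inv M n) : ∃ c, IsTransgression M φ c := by
  classical
  have : DiscreteTopology (G ⧸ M) := QuotientGroup.discreteTopology hM
  obtain ⟨s, hs, hs1⟩ : ∃ s : G ⧸ M → G, (∀ x, ((s x : G) : G ⧸ M) = x) ∧ s ((1 : G) : G ⧸ M) = 1 := by
    refine ⟨Function.update Quotient.out ((1 : G) : G ⧸ M) 1, fun x => ?_, by simp⟩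
    by_cases hx : x = ((1 : G) : G ⧸ M)
    · subst hx
      simp
    · rw [Function.update_of_ne hx]
      exact QuotientGroup.out_eq' x
  have hmem : ∀ g : G, (s (g : G ⧸ M))⁻¹ * g ∈ M := fun g =>
    QuotientGroup.eq.mp (hs (g : G ⧸ M))
  let y : G → ZMod n := fun g => φ.1.1 ⟨(s (g : G ⧸ M))⁻¹ * g, hmem g⟩
  have hmul : ∀ (g : G) (m : M), y (g * m) = y g + φ.1.1 m := by
    intro g m
    have hgm : ((g * m : G) : G ⧸ M) = (g : G ⧸ M) := by
      rw [QuotientGroup.mk_mul_of_mem g m.2]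
    change φ.1.1 _ = φ.1.1 _ + φ.1.1 m
    rw [← φ.1.2.2]
    refine congrArg φ.1.1 (Subtype.ext ?_)
    simp only [hgm, Subgroup.coe_mul, mul_assoc]
  have hyM : ∀ m : M, y m = φ.1.1 m := by
    intro m
    have hm : ((m : G) : G ⧸ M) = ((1 : G) : G ⧸ M) := by
      rw [QuotientGroup.eq]
      simp
    change φ.1.1 _ = φ.1.1 m
    refine congrArg φ.1.1 (Subtype.ext ?_)
    have hs1' : s (1 : G ⧸ M) = 1 := hs1
    simp [hm, hs1']
  have hyc : IsLocallyConstant y := by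
    rw [IsLocallyConstant.iff_exists_open]
    intro g
    have hK : IsOpen ((Subtype.val : M → G) '' (φ.1.1 ⁻¹' {0})) :=
      hM.isOpenMap_subtype_val _ (φ.1.2.1 {0})
    refine ⟨(fun x => g⁻¹ * x) ⁻¹' ((Subtype.val : M → G) '' (φ.1.1 ⁻¹' {0})),
      hK.preimage (continuous_const_mul g⁻¹), ⟨1, ?_, by simp⟩, ?_⟩
    · exact (H1.ker φ.1).one_mem
    · rintro x ⟨m, hm, hx⟩
      have hx' : x = g * m := by rw [hx]; simp
      rw [hx', hmul, show φ.1.1 m = 0 from hm, add_zero]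
  have hinv : ∀ (g h : G) (m : M), y (g * m * h) = y (g * h) + φ.1.1 m := by
    intro g h m
    have e := hmul (g * h) ⟨h⁻¹ * m * h, by simpa using hN.conj_mem m.1 m.2 h⁻¹⟩
    rw [φ.2 h m] at e
    rw [← e]
    congr 1
    simp only [mul_assoc, mul_inv_cancel_left]
  have hcob : ∀ (g h : G) (m m' : M), coboundary y (g * m, h * m') = coboundary y (g, h) := by
    intro g h m m'
    simp only [coboundary]
    rw [← mul_assoc, hmul, hmul, hmul, hinv]
    ring
  let F : (G ⧸ M) × (G ⧸ M) → ZMod n := fun x => coboundary y (s x.1, s x.2)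
  have hF : ∀ g h : G, F ((g : G ⧸ M), (h : G ⧸ M)) = coboundary y (g, h) := by
    intro g h
    have e := hcob (s (g : G ⧸ M)) (s (h : G ⧸ M)) ⟨_, hmem g⟩ ⟨_, hmem h⟩
    simp only [mul_inv_cancel_left] at e
    exact e.symm
  refine ⟨H2.mk ⟨F, IsLocallyConstant.of_discrete _, ?_⟩, y, ⟨F, _⟩, hyc, hyM, hF, rfl⟩
  intro g h k
  induction g using QuotientGroup.induction_on with
  | H g =>
    induction h using QuotientGroup.induction_on with
    | H h =>
      induction k using QuotientGroup.induction_on with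
      | H k =>
        rw [← QuotientGroup.mk_mul, ← QuotientGroup.mk_mul]
        simp only [hF, coboundary, mul_assoc]
        ring

/-- The transgression `trg_{G/M} : H¹(M)^G → H²(G/M)` for an open normal subgroup `M` of `G`: the
unique class singled out by `IsTransgression`. -/
noncomputable def trg {n : ℕ} [IsTopologicalGroup G] (M : Subgroup G) [M.Normal]
    (hM : IsOpen (M : Set G)) (φ : H1Inv M n) : H2 (G ⧸ M) n :=
  (exists_isTransgression M hM φ).choose

theorem trg_spec {n : ℕ} [IsTopologicalGroup G] (M : Subgroup G) [M.Normal]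
    (hM : IsOpen (M : Set G)) (φ : H1Inv M n) : IsTransgression M φ (trg M hM φ) :=
  (exists_isTransgression M hM φ).choose_spec

/-- `trg M hM φ` is the only class satisfying `IsTransgression M φ`. -/
theorem trg_eq_iff {n : ℕ} [IsTopologicalGroup G] (M : Subgroup G) [M.Normal]
    (hM : IsOpen (M : Set G)) (φ : H1Inv M n) (c : H2 (G ⧸ M) n) :
    trg M hM φ = c ↔ IsTransgression M φ c :=
  ⟨fun h => h ▸ trg_spec M hM φ, fun h => isTransgression_unique M hM φ _ _ (trg_spec M hM φ) h⟩

end Cohomology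

section Notions

variable (G : Type u) [Group G] [TopologicalSpace G]

/-- The descending `q`-central sequence, indexed from `1`: `G^{(1)} = G`, and `G^{(i+1)}` is the
closed subgroup of `G` generated by all `h ^ q` and all `[h, g] = h⁻¹ g⁻¹ h g` with `h ∈ G^{(i)}`,
`g ∈ G`.  (The index `0` is not used; the value there is `G`.) -/
def centralSeries [IsTopologicalGroup G] (q : ℕ) : ℕ → Subgroup G
  | 0 => ⊤
  | 1 => ⊤
  | (i + 2) => (Subgroup.closure
      ({x | ∃ h ∈ centralSeries q (i + 1), x = h ^ q} ∪
        {x | ∃ h ∈ centralSeries q (i + 1), ∃ g : G, x = h⁻¹ * g⁻¹ * h * g})).topologicalClosure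

/-- `G` has Galois relation type (with respect to `q = p ^ d`). -/
structure GaloisRelationType (p d : ℕ) [NeZero (p ^ d)] : Prop where
  /-- The kernel of `H¹(G) ⊗ H¹(G) → H²(G)` is generated by pure tensors. -/
  ker_cup : (cupTensor G (p ^ d)).ker = AddSubgroup.closure
    {t | t ∈ (cupTensor G (p ^ d)).ker ∧ ∃ ψ ψ' : H1 G (p ^ d), t = ψ ⊗ₜ[ℤ] ψ'}
  bockstein_eq : ∃ ξ : H1 G (p ^ d), ∀ ψ : H1 G (p ^ d), cup ψ ξ + bockstein ψ = 0
  reduce_surjective : ∀ i (_ : 1 ≤ i) (hi : i ≤ d),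
    Function.Surjective (H1.reduce (G := G) (pow_dvd_pow p hi))

/-- The group `Ω(G)`: it is `(H¹(G) ⊗ H¹(G)) ⊕ H¹(G)` if `q ≠ 2`, and `H¹(G) ⊗ H¹(G)`, identified
with the subgroup `(H¹(G) ⊗ H¹(G)) ⊕ 0`, if `q = 2`. -/
def Omega (q : ℕ) : AddSubgroup ((H1 G q ⊗[ℤ] H1 G q) × H1 G q) where
  carrier := {α | q = 2 → α.2 = 0}
  zero_mem' := fun _ => rfl
  add_mem' := by
    intro a b ha hb h
    simp [ha h, hb h]
  neg_mem' := by
    intro a ha h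
    simp [ha h]

variable {G}

/-- `Λ_G : Ω(G) → H²(G)`, given by `(α₁, α₂) ↦ ∪α₁ + β_G(α₂)` if `q ≠ 2`, and by the cup product
if `q = 2`. -/
noncomputable def Lambda {q : ℕ} [NeZero q] (α : Omega G q) : H2 G q :=
  if q = 2 then cupTensor G q α.1.1 else cupTensor G q α.1.1 + bockstein α.1.2

/-- The element of simple type attached to `ψ, ψ' ∈ H¹(G)`: it is `ψ ⊗ ψ'` if `q = 2`, and
`(ψ ⊗ ψ', ψ)` if `q ≠ 2`. -/
def simpleElement {q : ℕ} (ψ ψ' : H1 G q) : Omega G q :=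
  ⟨(ψ ⊗ₜ[ℤ] ψ', if q = 2 then 0 else ψ), fun h => if_pos h⟩

/-- `α ∈ Ω(G)` has simple type, and `K = Ker(ψ) ∩ Ker(ψ')` is a kernel of `α`. -/
def IsSimpleWithKernel {q : ℕ} (α : Omega G q) (K : Subgroup G) : Prop :=
  ∃ ψ ψ' : H1 G q, α = simpleElement ψ ψ' ∧ K = H1.ker ψ ⊓ H1.ker ψ'

/-- `N` is a distinguished subgroup of `G`: there are an open (normal) subgroup `M` of `G`, a class
`φ ∈ H¹(M)^G` and an element `α ∈ Ω(G/M)` of simple type and with trivial kernel such that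
`Λ_{G/M}(α) = trg_{G/M}(φ)` and `N = Ker(φ)`. -/
def IsDistinguished [IsTopologicalGroup G] (q : ℕ) [NeZero q] (N : Subgroup G) : Prop :=
  ∃ (M : Subgroup G) (_ : M.Normal) (hM : IsOpen (M : Set G)) (φ : H1Inv M q)
    (α : Omega (G ⧸ M) q),
    IsSimpleWithKernel α ⊥ ∧ Lambda α = trg M hM φ ∧ N = (H1.ker φ.1).map M.subtype

variable (G) in
/-- `Δ_G`: the intersection of all distinguished subgroups of `G`. -/
def Delta [IsTopologicalGroup G] (q : ℕ) [NeZero q] : Subgroup G :=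
  sInf {N | IsDistinguished q N}

end Notions

end QCentral

/-! The inclusion of `centralSeries G q 3` in `Delta G q` is formal: a simple element with trivial
kernel embeds `G/M` in `(ℤ/q)²`, so `M` contains `G^(2)`, and an invariant homomorphism `M → ℤ/q`
kills `h^q` and `[h, g]` for `h ∈ G^(2)`.

For the converse, fix `x ∈ Δ_G`. If `x ∉ G^(3)`, some open normal `K ⊇ G^(3)` misses `x`, and a
character of the central `q`-torsion of `G/K` gives an invariant `φ` on an open `M ⊇ G^(2)` with
`φ(x) ≠ 0`. So it is enough that every such `φ` vanishes at `x` (`H1Inv.eq_zero_of_mem_Delta`).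

Extend `φ` to a cochain `y` on `G` whose coboundary is inflated from `G/M`. By (iii), `G → G/M`
factors through a surjection onto some `(ℤ/q)^ι`. There every 2-cocycle is, up to a coboundary, a
combination of products and Bocksteins of coordinates (`IsAddCocycle.exists_normal_form`). Hence a
modification of `y` is a primitive of a combination of cup products and Bocksteins on `G`. By (ii),
Bocksteins become cup products; by (i), the resulting relation is a sum of relations `ψ ∪ ψ' = 0`.
Each of these comes from simple elements killed by `Λ`, whose primitives define distinguished
subgroups and so vanish at `x`. All of `H¹(G)` also vanishes at `x`, so the value of a primitive
there depends only on its coboundary, and `y(x) = 0`. -/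

namespace QCentral

universe u

/-! ### Splitting abelian extensions given by 2-cocycles. -/

section AbelianCocycles

variable {V A : Type*} [AddCommGroup V] [AddCommGroup A]

/-- The inhomogeneous 2-cocycle identity for the trivial action of `V` on `A`. -/
def IsAddCocycle (e : V → V → A) : Prop :=
  ∀ g h k, e h k - e (g + h) k + e g (h + k) - e g h = 0

theorem IsAddCocycle.zero_left {e : V → V → A} (he : IsAddCocycle e) (v : V) :
    e 0 v = e 0 0 := by
  have h := he 0 0 v
  simp only [zero_add, sub_self] at h
  exact sub_eq_zero.mp h

/-- The antisymmetrization of a 2-cocycle on an abelian group is biadditive. -/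
def IsAddCocycle.antisymm {e : V → V → A} (he : IsAddCocycle e) : V →+ V →+ A :=
  -- Additivity is the signed sum of the cocycle identities at `(u, v, w)`, `(w, u, v)` and `(u, w,
  -- v)`.
  have key : ∀ u v w, e (u + v) w - e w (u + v) = e u w - e w u + (e v w - e w v) := by
    intro u v w
    have h1 := he u v w
    have h2 := he w u v
    have h3 := he u w v
    rw [add_comm w u] at h2
    rw [add_comm w v] at h3
    rw [← sub_eq_zero]
    calc _ = -(e v w - e (u + v) w + e u (v + w) - e u v)
          - (e u v - e (u + w) v + e w (u + v) - e w u)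
          + (e w v - e (u + w) v + e u (v + w) - e u w) := by abel
      _ = 0 := by rw [h1, h2, h3]; simp
  AddMonoidHom.mk' (fun v => AddMonoidHom.mk' (fun w => e v w - e w v) (fun a b => by
      have := key a b v
      rw [← neg_sub, this, neg_add, neg_sub, neg_sub]))
    (fun a b => by ext w; exact key a b w)

theorem IsAddCocycle.antisymm_apply {e : V → V → A} (he : IsAddCocycle e) (v w : V) :
    he.antisymm v w = e v w - e w v := rfl

/-- The underlying type of the extension of `V` by `A` attached to a 2-cocycle `e`. -/
@[ext] structure CocycleExt (e : V → V → A) where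
  /-- The component in the quotient. -/
  base : V
  /-- The component in the kernel. -/
  fib : A

instance (e : V → V → A) : Add (CocycleExt e) :=
  ⟨fun x y => ⟨x.base + y.base, x.fib + y.fib + e x.base y.base⟩⟩

/-- The cocycle is not assumed normalized, so the neutral element needs the correction `-e 0 0`; the
negative needs it too. -/
instance (e : V → V → A) : Zero (CocycleExt e) := ⟨⟨0, -e 0 0⟩⟩

instance (e : V → V → A) : Neg (CocycleExt e) :=
  ⟨fun x => ⟨-x.base, -x.fib - e x.base (-x.base) - e 0 0⟩⟩

/-- The abelian extension attached to a symmetric 2-cocycle. -/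
@[reducible] def CocycleExt.addCommGroup {e : V → V → A} (he : IsAddCocycle e)
    (hs : ∀ v w, e v w = e w v) : AddCommGroup (CocycleExt e) where
  nsmul := nsmulRec
  zsmul := zsmulRec
  add_assoc x y z := by
    refine CocycleExt.ext (add_assoc _ _ _) ?_
    change x.fib + y.fib + e x.base y.base + z.fib + e (x.base + y.base) z.base =
      x.fib + (y.fib + z.fib + e y.base z.base) + e x.base (y.base + z.base)
    rw [← sub_eq_zero, ← neg_eq_zero, ← he x.base y.base z.base]
    abel
  zero_add x := by
    refine CocycleExt.ext (zero_add _) ?_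
    change -e 0 0 + x.fib + e 0 x.base = x.fib
    rw [he.zero_left x.base]
    abel
  add_zero x := by
    refine CocycleExt.ext (add_zero _) ?_
    change x.fib + -e 0 0 + e x.base 0 = x.fib
    rw [hs x.base 0, he.zero_left x.base]
    abel
  neg_add_cancel x := by
    refine CocycleExt.ext (neg_add_cancel _) ?_
    change -x.fib - e x.base (-x.base) - e 0 0 + x.fib + e (-x.base) x.base = -e 0 0
    rw [hs (-x.base)]
    abel
  add_comm x y := by
    refine CocycleExt.ext (add_comm _ _) ?_
    change x.fib + y.fib + e x.base y.base = y.fib + x.fib + e y.base x.base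
    rw [hs, add_comm x.fib]

theorem addMonoidHom_pi_zmod_ext {q : ℕ} {ι : Type*} [Finite ι] [DecidableEq ι]
    {f g : (ι → ZMod q) →+ A} (h : ∀ i, f (Pi.single i 1) = g (Pi.single i 1)) : f = g := by
  refine AddMonoidHom.functions_ext' _ _ _ fun i => ?_
  ext x
  obtain ⟨n, rfl⟩ := ZMod.intCast_surjective x
  have hx : (Pi.single i (n : ZMod q) : ι → ZMod q) = n • Pi.single i 1 := by
    rw [← Pi.single_smul, zsmul_one]
  simp only [AddMonoidHom.comp_apply, AddMonoidHom.single_apply, hx, map_zsmul, h]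

/-- A 2-cocycle on `(ℤ/q)^ι` that is symmetric on the standard basis and has trivial norm on each
basis vector is a coboundary. -/
theorem IsAddCocycle.exists_primitive {q : ℕ} {ι : Type*} [Fintype ι] [DecidableEq ι]
    {e : (ι → ZMod q) → (ι → ZMod q) → A} (he : IsAddCocycle e)
    (hs : ∀ i j, e (Pi.single i 1) (Pi.single j 1) = e (Pi.single j 1) (Pi.single i 1))
    (hn : ∀ i, ∑ k ∈ Finset.range q, e (k • Pi.single i 1) (Pi.single i 1) = 0) :
    ∃ z : (ι → ZMod q) → A, ∀ v w, e v w = z w - z (v + w) + z v := by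
  -- Being biadditive, the antisymmetrization vanishes once it does on basis vectors; the extension
  -- is then commutative.
  have hD : he.antisymm = 0 := by
    refine addMonoidHom_pi_zmod_ext fun i => addMonoidHom_pi_zmod_ext fun j => ?_
    simpa [he.antisymm_apply, sub_eq_zero] using hs i j
  have hs' : ∀ v w, e v w = e w v := fun v w => by
    rw [← sub_eq_zero, ← he.antisymm_apply, hD]
    rfl
  let _ := CocycleExt.addCommGroup he hs'
  let pr : CocycleExt e →+ (ι → ZMod q) := AddMonoidHom.mk' CocycleExt.base (fun _ _ => rfl)
  have hmul : ∀ (v : ι → ZMod q) (m : ℕ), m • (⟨v, 0⟩ : CocycleExt e) =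
      ⟨m • v, ∑ k ∈ Finset.range m, e (k • v) v - e 0 0⟩ := by
    intro v m
    induction m with
    | zero =>
      rw [zero_smul]
      refine CocycleExt.ext (zero_smul ℕ v).symm ?_
      simp only [Finset.range_zero, Finset.sum_empty, zero_sub]
      rfl
    | succ m ih =>
      rw [succ_nsmul, ih]
      refine CocycleExt.ext (succ_nsmul v m).symm ?_
      rw [Finset.sum_range_succ]
      change ∑ k ∈ Finset.range m, e (k • v) v - e 0 0 + 0 + e (m • v) v =
        ∑ k ∈ Finset.range m, e (k • v) v + e (m • v) v - e 0 0
      rw [add_zero, sub_add_eq_add_sub]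
  -- The `q`-th multiple of the lift of a basis vector is measured by the norm in `hn`. As it
  -- vanishes, the lifts define a homomorphic section `s`, and minus its fibre component is the
  -- primitive.
  have hq : ∀ i, (q : ℤ) • (⟨Pi.single i 1, 0⟩ : CocycleExt e) = 0 := by
    intro i
    rw [natCast_zsmul, hmul, hn]
    refine CocycleExt.ext ?_ (zero_sub _)
    change q • (Pi.single i 1 : ι → ZMod q) = 0
    rw [← Pi.single_smul]
    simp
  let s : (ι → ZMod q) →+ CocycleExt e := ∑ i, (ZMod.lift q
    ⟨(zmultiplesHom _) (⟨Pi.single i 1, 0⟩ : CocycleExt e), by simpa using hq i⟩).comp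
      (Pi.evalAddMonoidHom _ i)
  have hsec : pr.comp s = AddMonoidHom.id _ := by
    refine addMonoidHom_pi_zmod_ext fun i => ?_
    have : s (Pi.single i 1) = ⟨Pi.single i 1, 0⟩ := by
      simp only [s, AddMonoidHom.finsetSum_apply]
      rw [Finset.sum_eq_single i]
      · simp [← Int.cast_one (R := ZMod q), -Int.cast_one]
      · intro j _ hj
        simp [hj]
      · simp
    rw [AddMonoidHom.comp_apply, this]
    rfl
  have hbase : ∀ v, (s v).base = v := fun v => DFunLike.congr_fun hsec v
  refine ⟨fun v => -(s v).fib, fun v w => ?_⟩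
  have h1 := congrArg CocycleExt.fib (s.map_add v w)
  change _ = (s v).fib + (s w).fib + e (s v).base (s w).base at h1
  rw [hbase, hbase] at h1
  simp only [h1]
  abel

end AbelianCocycles

/-! ### The carry cocycle and 2-cocycles on `(ℤ/q)^ι`. -/

section Carry

variable {q : ℕ}

/-- The carry of the addition in `ℤ/q` of representatives in `{0, …, q - 1}`. -/
def zmodCarry (a b : ZMod q) : ℤ := ((a.val : ℤ) + (b.val : ℤ) - ((a + b).val : ℤ)) / (q : ℤ)

theorem zmodCarry_comm (a b : ZMod q) : zmodCarry a b = zmodCarry b a := by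
  simp only [zmodCarry, add_comm]

variable [NeZero q]

theorem mul_zmodCarry (a b : ZMod q) :
    (q : ℤ) * zmodCarry a b = (a.val : ℤ) + (b.val : ℤ) - ((a + b).val : ℤ) := by
  apply Int.mul_ediv_cancel'
  rw [← ZMod.intCast_zmod_eq_zero_iff_dvd]
  simp

theorem zmodCarry_zero_left (a : ZMod q) : zmodCarry 0 a = 0 := by simp [zmodCarry]

theorem zmodCarry_zero_right (a : ZMod q) : zmodCarry a 0 = 0 := by simp [zmodCarry]

theorem isAddCocycle_zmodCarry : IsAddCocycle (zmodCarry (q := q)) := by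
  intro a b c
  have hq : (q : ℤ) ≠ 0 := by exact_mod_cast NeZero.ne q
  apply mul_left_cancel₀ hq
  have e1 := mul_zmodCarry b c
  have e2 := mul_zmodCarry (a + b) c
  have e3 := mul_zmodCarry a (b + c)
  have e4 := mul_zmodCarry a b
  simp only [add_assoc] at e1 e2 e3 e4 ⊢
  linear_combination e1 - e2 + e3 - e4

/-- After multiplication by `q` the sum telescopes. At `a = 1` the norm is `1` in `ℤ/q`, so
multiples of the carry realize every norm. -/
theorem sum_zmodCarry (a : ZMod q) : ∑ k ∈ Finset.range q, zmodCarry (k • a) a = a.val := by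
  have hq : (q : ℤ) ≠ 0 := by exact_mod_cast NeZero.ne q
  apply mul_left_cancel₀ hq
  rw [Finset.mul_sum]
  have h : ∀ k ∈ Finset.range q, (q : ℤ) * zmodCarry (k • a) a =
      (((k • a).val : ℤ) - (((k + 1) • a).val : ℤ)) + (a.val : ℤ) := by
    intro k _
    rw [mul_zmodCarry, succ_nsmul]
    ring
  rw [Finset.sum_congr rfl h, Finset.sum_add_distrib,
    Finset.sum_range_sub' (fun k : ℕ => ((k • a).val : ℤ))]
  simp

/-- Every 2-cocycle on `(ℤ/q)^ι` is cohomologous to a combination of products of two coordinates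
and of Bocksteins of coordinates. -/
theorem IsAddCocycle.exists_normal_form {ι : Type*} [Fintype ι] [LinearOrder ι]
    {f : (ι → ZMod q) → (ι → ZMod q) → ZMod q} (hf : IsAddCocycle f) :
    ∃ (a : ι → ι → ZMod q) (b : ι → ZMod q) (z : (ι → ZMod q) → ZMod q), ∀ v w,
      f v w = ∑ i, ∑ j, a i j * (v i * w j) + ∑ i, b i * (zmodCarry (v i) (w i) : ZMod q) +
        (z w - z (v + w) + z v) := by
  -- The coefficients `a` match the antisymmetrization of `f` on basis pairs, and `b` its norms. The
  -- two corrections do not interfere: carries are symmetric, and `a` has zero diagonal, so the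
  -- products have norm zero on basis vectors.
  let a : ι → ι → ZMod q := fun i j =>
    if i < j then f (Pi.single i 1) (Pi.single j 1) - f (Pi.single j 1) (Pi.single i 1) else 0
  let b : ι → ZMod q := fun i => ∑ k ∈ Finset.range q, f (k • Pi.single i 1) (Pi.single i 1)
  let e : (ι → ZMod q) → (ι → ZMod q) → ZMod q := fun v w =>
    f v w - ∑ i, ∑ j, a i j * (v i * w j) - ∑ i, b i * (zmodCarry (v i) (w i) : ZMod q)
  have he : IsAddCocycle e := by
    intro g h k
    have h1 := hf g h k
    have h2 : ∑ i, ∑ j, a i j * (h i * k j) - ∑ i, ∑ j, a i j * ((g + h) i * k j)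
        + ∑ i, ∑ j, a i j * (g i * (h + k) j) - ∑ i, ∑ j, a i j * (g i * h j) = 0 := by
      simp only [← Finset.sum_sub_distrib, ← Finset.sum_add_distrib, Pi.add_apply]
      refine Finset.sum_eq_zero fun i _ => Finset.sum_eq_zero fun j _ => ?_
      ring
    have h3 : ∑ i, b i * (zmodCarry (h i) (k i) : ZMod q)
        - ∑ i, b i * (zmodCarry ((g + h) i) (k i) : ZMod q)
        + ∑ i, b i * (zmodCarry (g i) ((h + k) i) : ZMod q)
        - ∑ i, b i * (zmodCarry (g i) (h i) : ZMod q) = 0 := by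
      simp only [← Finset.sum_sub_distrib, ← Finset.sum_add_distrib, Pi.add_apply]
      refine Finset.sum_eq_zero fun i _ => ?_
      have := congrArg (Int.cast : ℤ → ZMod q) (isAddCocycle_zmodCarry (g i) (h i) (k i))
      push_cast at this
      linear_combination b i * this
    linear_combination h1 - h2 - h3
  have hcarry : ∀ i j l, zmodCarry ((Pi.single i 1 : ι → ZMod q) l)
      ((Pi.single j 1 : ι → ZMod q) l) =
        zmodCarry ((Pi.single j 1 : ι → ZMod q) l) ((Pi.single i 1 : ι → ZMod q) l) :=
    fun i j l => zmodCarry_comm _ _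
  obtain ⟨z, hz⟩ := he.exists_primitive (fun i j => by
      have ha : ∀ i j, ∑ k, ∑ l, a k l * ((Pi.single i 1 : ι → ZMod q) k *
          (Pi.single j 1 : ι → ZMod q) l) = a i j := by
        intro i j
        simp [Pi.single_apply]
      simp only [e, ha, hcarry i j]
      rcases lt_trichotomy i j with h | h | h
      · simp [a, h, h.not_gt]
      · simp [h]
      · simp [a, h, h.not_gt])
    (fun i => by
      have ha : ∀ m : ℕ, ∑ k, ∑ l, a k l * ((m • (Pi.single i 1 : ι → ZMod q)) k *
          (Pi.single i 1 : ι → ZMod q) l) = 0 := by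
        intro m
        simp [Pi.single_apply, a]
      have hb : ∀ m : ℕ, ∑ k, b k * (zmodCarry ((m • (Pi.single i 1 : ι → ZMod q)) k)
          ((Pi.single i 1 : ι → ZMod q) k) : ZMod q) =
            b i * (zmodCarry (m • (1 : ZMod q)) 1 : ZMod q) := by
        intro m
        rw [Finset.sum_eq_single i]
        · simp
        · intro k _ hk
          simp [hk, zmodCarry_zero_right]
        · simp
      simp only [e, ha, hb, Finset.sum_sub_distrib, ← Finset.mul_sum, ← Int.cast_sum,
        sum_zmodCarry]
      simp [b])
  refine ⟨a, b, z, fun v w => ?_⟩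
  rw [← hz]
  simp only [e]
  ring

end Carry

/-! ### Characters of finite abelian groups of exponent dividing `q`. -/

section FiniteAbelian

/-- Coordinates on a finite abelian group of exponent dividing `q`. -/
theorem exists_zmod_coordinates (A : Type*) [CommGroup A] [Finite A] {q : ℕ}
    (hA : ∀ a : A, a ^ q = 1) :
    ∃ (ι : Type) (_ : Fintype ι) (n : ι → ℕ) (t : ∀ i, A → ZMod (n i)),
      (∀ i, 1 < n i ∧ n i ∣ q) ∧ (∀ i a b, t i (a * b) = t i a + t i b) ∧
      (∀ a, (∀ i, t i a = 0) → a = 1) ∧ ∀ v : ∀ i, ZMod (n i), ∃ a, ∀ i, t i a = v i := by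
  classical
  obtain ⟨ι, hι, n, hn, ⟨e⟩⟩ := CommGroup.equiv_prod_multiplicative_zmod_of_finite A
  have hsurj : ∀ v : ∀ i, ZMod (n i), ∃ a, ∀ i, (e a i).toAdd = v i := fun v =>
    ⟨e.symm fun i => Multiplicative.ofAdd (v i), fun i => by simp⟩
  refine ⟨ι, hι, n, fun i a => (e a i).toAdd, fun i => ⟨hn i, ?_⟩, fun i a b => by simp,
    fun a ha => ?_, hsurj⟩
  · obtain ⟨a, ha⟩ := hsurj fun _ => 1
    rw [← ZMod.natCast_eq_zero_iff, ← nsmul_one, ← ha i, ← toAdd_pow, ← Pi.pow_apply, ← map_pow,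
      hA]
    simp
  · rw [← e.map_eq_one_iff]
    ext i
    exact ha i

/-- Homomorphisms to `ℤ/q` separate the elements of a finite abelian group of exponent dividing
`q`. -/
theorem exists_zmod_character_ne_zero {A : Type*} [CommGroup A] [Finite A] {q : ℕ} [NeZero q]
    (hA : ∀ a : A, a ^ q = 1) {a : A} (ha : a ≠ 1) :
    ∃ f : A → ZMod q, (∀ x y, f (x * y) = f x + f y) ∧ f a ≠ 0 := by
  obtain ⟨ι, _, n, t, hn, hadd, hinj, -⟩ := exists_zmod_coordinates A hA
  obtain ⟨i, hi⟩ : ∃ i, t i a ≠ 0 := by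
    by_contra! h
    exact ha (hinj a h)
  -- With `q = n i * m`, multiplication by `m` embeds `ℤ/(n i)` into `ℤ/q`.
  obtain ⟨m, hm⟩ := (hn i).2
  have hlift : (zmultiplesHom (ZMod q) (m : ZMod q)) (n i) = 0 := by
    simp [← Nat.cast_mul, ← hm]
  have hL : Function.Injective (ZMod.lift (n i) ⟨zmultiplesHom (ZMod q) (m : ZMod q), hlift⟩) := by
    rw [ZMod.lift_injective]
    intro k hk
    have hm0 : (m : ℤ) ≠ 0 := by
      rintro h
      apply NeZero.ne q
      rw [hm, Int.natCast_eq_zero.mp h, mul_zero]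
    simp only [zmultiplesHom_apply, zsmul_eq_mul] at hk
    rw [ZMod.intCast_zmod_eq_zero_iff_dvd]
    have hk' : ((k * m : ℤ) : ZMod q) = 0 := by exact_mod_cast hk
    rw [ZMod.intCast_zmod_eq_zero_iff_dvd, hm, Nat.cast_mul] at hk'
    exact (mul_dvd_mul_iff_right hm0).mp hk'
  refine ⟨fun x => ZMod.lift (n i) ⟨_, hlift⟩ (t i x), fun x y => by simp only [hadd, map_add], ?_⟩
  exact fun h => hi (hL (h.trans (map_zero _).symm))

end FiniteAbelian

/-! ### Abelian quotients of `G` and coordinates in `ℤ/p^d`. -/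

section Coordinates

variable {G : Type u} [Group G] [TopologicalSpace G]

theorem H1.map_one {n : ℕ} (ψ : H1 G n) : ψ.1 1 = 0 := (H1.ker ψ).one_mem

theorem H1.map_pow {n : ℕ} (ψ : H1 G n) (g : G) (k : ℕ) : ψ.1 (g ^ k) = k * ψ.1 g := by
  induction k with
  | zero => simp [H1.map_one]
  | succ k ih =>
    rw [pow_succ, ψ.2.2, ih]
    push_cast
    ring

theorem H1.map_inv {n : ℕ} (ψ : H1 G n) (g : G) : ψ.1 g⁻¹ = -ψ.1 g := by
  rw [eq_neg_iff_add_eq_zero, ← ψ.2.2, inv_mul_cancel, H1.map_one]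

theorem H1.map_comm {n : ℕ} (ψ : H1 G n) (g h : G) : ψ.1 (h⁻¹ * g⁻¹ * h * g) = 0 := by
  simp only [ψ.2.2, H1.map_inv]
  ring

/-- Inflation of a homomorphism along the quotient by an open normal subgroup. -/
def H1.infl [IsTopologicalGroup G] {n : ℕ} {M : Subgroup G} [M.Normal] (hM : IsOpen (M : Set G))
    (f : G ⧸ M → ZMod n) (hf : ∀ x y, f (x * y) = f x + f y) : H1 G n :=
  ⟨fun g => f g,
    have : DiscreteTopology (G ⧸ M) := QuotientGroup.discreteTopology hM
    (IsLocallyConstant.of_discrete f).comp_continuous QuotientGroup.continuous_mk,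
    fun g h => hf g h⟩

/-- The quotient by a normal subgroup containing all commutators is commutative. -/
@[reducible] def quotientCommGroup {G : Type*} [Group G] (M : Subgroup G) [M.Normal]
    (hab : ∀ g h : G, h⁻¹ * g⁻¹ * h * g ∈ M) : CommGroup (G ⧸ M) :=
  { (inferInstance : Group (G ⧸ M)) with
    mul_comm := by
      intro a b
      induction a using QuotientGroup.induction_on with
      | H a =>
        induction b using QuotientGroup.induction_on with
        | H b =>
          rw [← QuotientGroup.mk_mul, ← QuotientGroup.mk_mul, QuotientGroup.eq]
          simpa [mul_assoc] using hab a b }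

variable [IsTopologicalGroup G] [CompactSpace G]

/-- An element killed by every homomorphism to `ℤ/q` lies in every open normal subgroup whose
quotient is abelian of exponent dividing `q`. -/
theorem mem_of_forall_H1_eq_zero {q : ℕ} [NeZero q] {M : Subgroup G} [M.Normal]
    (hM : IsOpen (M : Set G)) (hpow : ∀ g : G, g ^ q ∈ M)
    (hab : ∀ g h : G, h⁻¹ * g⁻¹ * h * g ∈ M) {x : G} (hx : ∀ ψ : H1 G q, ψ.1 x = 0) : x ∈ M := by
  by_contra hxM
  let _ := quotientCommGroup M hab
  have : Finite (G ⧸ M) := Subgroup.quotient_finite_of_isOpen M hM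
  obtain ⟨f, hf, hfx⟩ := exists_zmod_character_ne_zero (A := G ⧸ M) (q := q) (a := (x : G ⧸ M))
    (fun a => by
      induction a using QuotientGroup.induction_on with
      | H a => rw [← QuotientGroup.mk_pow, QuotientGroup.eq_one_iff]; exact hpow a)
    (by rwa [ne_eq, QuotientGroup.eq_one_iff])
  exact hfx (hx (H1.infl hM f hf))

theorem dvd_of_castHom_eq_zero {p k d : ℕ} [NeZero (p ^ d)] (hk : 1 ≤ k) (hkd : k ≤ d)
    {x : ZMod (p ^ d)} (hx : ZMod.castHom (pow_dvd_pow p hkd) (ZMod (p ^ k)) x = 0) :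
    (p : ZMod (p ^ d)) ∣ x := by
  rw [← ZMod.natCast_zmod_val x, map_natCast, ZMod.natCast_eq_zero_iff] at hx
  obtain ⟨m, hm⟩ := (dvd_pow_self p (Nat.one_le_iff_ne_zero.mp hk)).trans hx
  exact ⟨m, by rw [← ZMod.natCast_zmod_val x, hm, Nat.cast_mul]⟩

/-- If homomorphisms to `ℤ/pⁱ` lift to `ℤ/p^d`, then every open normal subgroup with abelian
quotient of exponent dividing `p^d` contains the kernel of a continuous surjection onto some
`(ℤ/p^d)^ι`. -/
theorem exists_surjective_coordinates {p d : ℕ} [Fact p.Prime]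
    (hred : ∀ i (_ : 1 ≤ i) (hi : i ≤ d),
      Function.Surjective (H1.reduce (G := G) (pow_dvd_pow p hi)))
    {M : Subgroup G} [M.Normal] (hM : IsOpen (M : Set G)) (hpow : ∀ g : G, g ^ p ^ d ∈ M)
    (hab : ∀ g h : G, h⁻¹ * g⁻¹ * h * g ∈ M) :
    ∃ (ι : Type) (_ : Fintype ι) (χ : ι → H1 G (p ^ d)),
      (∀ g, (∀ i, (χ i).1 g = 0) → g ∈ M) ∧
      ∀ v : ι → ZMod (p ^ d), ∃ g, ∀ i, (χ i).1 g = v i := by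
  let _ := quotientCommGroup M hab
  have : Finite (G ⧸ M) := Subgroup.quotient_finite_of_isOpen M hM
  obtain ⟨ι, hι, n, t, hn, hadd, hinj, hsurj⟩ := exists_zmod_coordinates (G ⧸ M) (q := p ^ d)
    (fun a => by
      induction a using QuotientGroup.induction_on with
      | H a => rw [← QuotientGroup.mk_pow, QuotientGroup.eq_one_iff]; exact hpow a)
  have hk : ∀ i, ∃ k, k ≤ d ∧ n i = p ^ k := fun i =>
    (Nat.dvd_prime_pow (Fact.out : p.Prime)).mp (hn i).2
  choose k hkd hnk using hk
  obtain rfl : n = fun i => p ^ k i := funext hnk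
  have hk1 : ∀ i, 1 ≤ k i := fun i => Nat.one_le_iff_ne_zero.mpr fun h => by
    simpa [h] using (hn i).1
  have hlift := fun i => hred (k i) (hk1 i) (hkd i) (H1.infl hM (t i) (hadd i))
  choose χ hχ using hlift
  have hχt : ∀ i g, ZMod.castHom (pow_dvd_pow p (hkd i)) (ZMod (p ^ k i)) ((χ i).1 g) = t i g :=
    fun i g => congrFun (congrArg Subtype.val (hχ i)) g
  refine ⟨ι, hι, χ, fun g hg => ?_, ?_⟩
  · rw [← QuotientGroup.eq_one_iff]
    refine hinj _ fun i => ?_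
    rw [← hχt, hg, map_zero]
  -- A Nakayama argument: the lifted coordinates are jointly surjective modulo `p`, since each `k i
  -- ≥ 1`. Iterating `d` times leaves an error divisible by `p ^ d = 0`.
  have step : ∀ v : ι → ZMod (p ^ d), ∃ g, ∃ w : ι → ZMod (p ^ d),
      ∀ i, v i = (χ i).1 g + p * w i := by
    intro v
    obtain ⟨a, ha⟩ := hsurj fun i => ZMod.castHom (pow_dvd_pow p (hkd i)) (ZMod (p ^ k i)) (v i)
    obtain ⟨g, rfl⟩ := QuotientGroup.mk_surjective a
    have : ∀ i, ∃ w, v i - (χ i).1 g = p * w := fun i =>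
      dvd_of_castHom_eq_zero (hk1 i) (hkd i) (by rw [map_sub, hχt, ha, sub_self])
    choose w hw using this
    exact ⟨g, w, fun i => by rw [← hw]; ring⟩
  have approx : ∀ (m : ℕ) (v : ι → ZMod (p ^ d)), ∃ g, ∃ w : ι → ZMod (p ^ d),
      ∀ i, v i = (χ i).1 g + (p ^ m : ℕ) * w i := by
    intro m v
    induction m with
    | zero => exact ⟨1, v, fun i => by simp [H1.map_one]⟩
    | succ m ih =>
      obtain ⟨g, w, hw⟩ := ih
      obtain ⟨g', w', hw'⟩ := step w
      refine ⟨g * g' ^ p ^ m, w', fun i => ?_⟩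
      rw [(χ i).2.2, H1.map_pow, hw, hw']
      push_cast
      ring
  intro v
  obtain ⟨g, w, hw⟩ := approx d v
  exact ⟨g, fun i => by rw [hw, ZMod.natCast_self]; ring⟩

end Coordinates

/-! ### Cup product relations and primitives vanishing on `Δ_G`. -/

section Primitives

variable {G : Type u} [Group G] [TopologicalSpace G]

theorem H2.mk_add {n : ℕ} (c c' : Z2 G n) : H2.mk (c + c') = H2.mk c + H2.mk c' := rfl

theorem H2.mk_eq_zero_iff {n : ℕ} (c : Z2 G n) :
    H2.mk c = 0 ↔ ∃ y : G → ZMod n, IsLocallyConstant y ∧ c.1 = coboundary y := by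
  unfold H2.mk
  rw [QuotientAddGroup.eq_zero_iff, AddSubgroup.mem_addSubgroupOf]
  rfl

/-- The 2-cocycles that are the coboundary of a continuous cochain vanishing at `x`. -/
def primitiveVanishingAt (n : ℕ) (x : G) : AddSubgroup (Z2 G n) where
  carrier := {c | ∃ y : G → ZMod n, IsLocallyConstant y ∧ c.1 = coboundary y ∧ y x = 0}
  zero_mem' := ⟨0, IsLocallyConstant.const 0, by funext x; simp [coboundary], rfl⟩
  add_mem' := by
    rintro a b ⟨y, hy, ha, hyx⟩ ⟨z, hz, hb, hzx⟩
    refine ⟨y + z, hy.add hz, ?_, by simp [hyx, hzx]⟩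
    funext x
    simp only [AddSubgroup.coe_add, Pi.add_apply, ha, hb, coboundary]
    ring
  neg_mem' := by
    rintro a ⟨y, hy, ha, hyx⟩
    refine ⟨-y, hy.neg, ?_, by simp [hyx]⟩
    funext x
    simp only [AddSubgroup.coe_neg, Pi.neg_apply, ha, coboundary]
    ring

theorem mk_eq_zero_of_mem_primitiveVanishingAt {n : ℕ} {x : G} {c : Z2 G n}
    (hc : c ∈ primitiveVanishingAt n x) : H2.mk c = 0 := by
  obtain ⟨y, hy, hcy, -⟩ := hc
  exact (H2.mk_eq_zero_iff c).mpr ⟨y, hy, hcy⟩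

/-- If all homomorphisms to `ℤ/n` vanish at `x`, then the value of a primitive at `x` only depends
on its coboundary. -/
theorem eq_zero_of_mem_primitiveVanishingAt {n : ℕ} {x : G} (hx : ∀ ψ : H1 G n, ψ.1 x = 0)
    {c : Z2 G n} (hc : c ∈ primitiveVanishingAt n x) {y : G → ZMod n} (hy : IsLocallyConstant y)
    (hcy : c.1 = coboundary y) : y x = 0 := by
  obtain ⟨y', hy', hcy', hx'⟩ := hc
  -- Two primitives of the same cocycle differ by a homomorphism.
  have := hx ⟨y - y', hy.sub hy', fun g h => by
    have e := congrFun (hcy.symm.trans hcy') (g, h)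
    simp only [coboundary] at e
    simp only [Pi.sub_apply]
    linear_combination -e⟩
  simpa [hx'] using this

/-- The cup product as a biadditive map on the level of cocycles. -/
def cupCocycleHom {n : ℕ} : H1 G n →+ H1 G n →+ Z2 G n :=
  AddMonoidHom.mk' (fun ψ => AddMonoidHom.mk' (fun ψ' => cupCocycle ψ ψ')
    (fun a b => by ext x; simp [cupCocycle, mul_add]))
    (fun a b => by ext c x; simp [cupCocycle, add_mul])

variable (G) in
/-- The cup product of a tensor on the level of cocycles. -/
noncomputable def cupCocycleTensor (n : ℕ) : H1 G n ⊗[ℤ] H1 G n →+ Z2 G n :=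
  TensorProduct.liftAddHom cupCocycleHom (fun r a b => by simp)

theorem cupCocycleTensor_tmul {n : ℕ} (ψ ψ' : H1 G n) :
    cupCocycleTensor G n (ψ ⊗ₜ[ℤ] ψ') = cupCocycle ψ ψ' := rfl

theorem mk_cupCocycleTensor {n : ℕ} (t : H1 G n ⊗[ℤ] H1 G n) :
    H2.mk (cupCocycleTensor G n t) = cupTensor G n t := by
  induction t using TensorProduct.induction_on with
  | zero => rw [map_zero, map_zero]; rfl
  | tmul ψ ψ' => rfl
  | add a b ha hb => rw [map_add, map_add, H2.mk_add, ha, hb]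

theorem carry_eq_zmodCarry {q : ℕ} (ψ : H1 G q) (g h : G) :
    carry ψ (g, h) = zmodCarry (ψ.1 g) (ψ.1 h) := by
  simp only [carry, zmodCarry, ψ.2.2]

variable {q : ℕ} [NeZero q]

/-- The 2-cocycle representing the image under `Λ` of an element of simple type. -/
def simpleCocycle (ψ ψ' : H1 G q) : Z2 G q :=
  if q = 2 then cupCocycle ψ ψ' else cupCocycle ψ ψ' + bocksteinCocycle ψ

theorem Lambda_simpleElement (ψ ψ' : H1 G q) :
    Lambda (simpleElement ψ ψ') = H2.mk (simpleCocycle ψ ψ') := by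
  unfold Lambda simpleElement simpleCocycle
  split_ifs <;> rfl

theorem bocksteinCocycle_apply (ψ : H1 G q) (g h : G) :
    (bocksteinCocycle ψ).1 (g, h) = (zmodCarry (ψ.1 g) (ψ.1 h) : ZMod q) := by
  rw [← carry_eq_zmodCarry]
  rfl

/-- The carry of two bits is their product. This disposes of Bocksteins when `q = 2`, where `Λ` has
no Bockstein term. -/
theorem bocksteinCocycle_eq_cupCocycle_of_eq_two (hq : q = 2) (ψ : H1 G q) :
    bocksteinCocycle ψ = cupCocycle ψ ψ := by
  subst hq
  have key : ∀ a b : ZMod 2, ((zmodCarry a b : ℤ) : ZMod 2) = a * b := by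
    have : ∀ a b : ZMod 2, zmodCarry a b = ((a * b).val : ℤ) := by
      intro a b
      have h := mul_zmodCarry a b
      have h2 : ∀ a b : ZMod 2, a.val + b.val = 2 * (a * b).val + (a + b).val := by decide
      have := h2 a b
      push_cast at h
      lia
    intro a b
    rw [this, Int.cast_natCast, ZMod.natCast_zmod_val]
  ext ⟨g, h⟩
  rw [bocksteinCocycle_apply, key]
  rfl

theorem simpleCocycle_apply (ψ ψ' : H1 G q) (g h : G) :
    (simpleCocycle ψ ψ').1 (g, h) = ψ.1 g * ψ'.1 h +
      if q = 2 then 0 else (zmodCarry (ψ.1 g) (ψ.1 h) : ZMod q) := by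
  unfold simpleCocycle
  split_ifs
  · rw [add_zero]
    rfl
  · rw [← bocksteinCocycle_apply]
    rfl

theorem H1.isOpen_ker {n : ℕ} (ψ : H1 G n) : IsOpen (H1.ker ψ : Set G) := ψ.2.1 {0}

instance H1.normal_ker {n : ℕ} (ψ : H1 G n) : (H1.ker ψ).Normal :=
  ⟨fun m (hm : ψ.1 m = 0) g => by
    change ψ.1 (g * m * g⁻¹) = 0
    rw [ψ.2.2, ψ.2.2, H1.map_inv, hm]
    ring⟩

variable [IsTopologicalGroup G]

/-- The homomorphism on the quotient by an open normal subgroup of the kernel. -/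
def H1.descend {n : ℕ} (ψ : H1 G n) (M : Subgroup G) [M.Normal] (hM : IsOpen (M : Set G))
    (h : M ≤ H1.ker ψ) : H1 (G ⧸ M) n :=
  have hadd : ∀ a b : G ⧸ M,
      (Quotient.lift (s := QuotientGroup.leftRel M) ψ.1 fun a b hab => by
        have hab' : ψ.1 (a⁻¹ * b) = 0 := h (QuotientGroup.leftRel_apply.mp hab)
        rw [ψ.2.2, H1.map_inv] at hab'
        linear_combination -hab' : G ⧸ M → ZMod n) (a * b) = _ + _ := by
    intro a b
    induction a using QuotientGroup.induction_on with
    | H a =>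
      induction b using QuotientGroup.induction_on with
      | H b => exact ψ.2.2 a b
  ⟨_, have : DiscreteTopology (G ⧸ M) := QuotientGroup.discreteTopology hM
    IsLocallyConstant.of_discrete _, hadd⟩

theorem H1.descend_mk {n : ℕ} (ψ : H1 G n) (M : Subgroup G) [M.Normal] (hM : IsOpen (M : Set G))
    (h : M ≤ H1.ker ψ) (g : G) : (H1.descend ψ M hM h).1 (g : G ⧸ M) = ψ.1 g := rfl

/-- An element of simple type killed by `Λ_G` gives rise to a distinguished subgroup. -/
theorem mem_primitiveVanishingAt_of_mem_Delta {x : G} (hx : x ∈ Delta G q) (ψ ψ' : H1 G q)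
    (h0 : H2.mk (simpleCocycle ψ ψ') = 0) :
    ψ.1 x = 0 ∧ simpleCocycle ψ ψ' ∈ primitiveVanishingAt q x := by
  obtain ⟨y, hy, hcy⟩ := (H2.mk_eq_zero_iff _).mp h0
  have hc : ∀ g h, ψ.1 g * ψ'.1 h +
      (if q = 2 then 0 else (zmodCarry (ψ.1 g) (ψ.1 h) : ZMod q)) = y h - y (g * h) + y g :=
    fun g h => by rw [← simpleCocycle_apply, hcy]; rfl
  let M := H1.ker ψ ⊓ H1.ker ψ'
  have hM : IsOpen (M : Set G) := (H1.isOpen_ker ψ).inter (H1.isOpen_ker ψ')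
  -- The simple cocycle vanishes when either argument lies in `M`. Hence `y` is additive on `M`, and
  -- expanding `y (m * g) = y (g * (g⁻¹ * m * g))` in both ways shows it is invariant.
  have hl : ∀ (m : M) g, y (m * g) = y m + y g := fun m g => by
    have h1 : ψ.1 m = 0 := m.2.1
    have := hc m g
    simp only [h1, zmodCarry_zero_left, Int.cast_zero, ite_self] at this
    linear_combination this
  have hr : ∀ (m : M) g, y (g * m) = y g + y m := fun m g => by
    have h1 : ψ.1 m = 0 := m.2.1
    have h2 : ψ'.1 m = 0 := m.2.2
    have := hc g m
    simp only [h1, h2, zmodCarry_zero_right, Int.cast_zero, ite_self] at this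
    linear_combination this
  let φ : H1Inv M q := ⟨⟨fun m => y m, hy.comp_continuous continuous_subtype_val,
    fun a b => hl a b⟩, fun g m => by
      have e := hr ⟨g⁻¹ * m * g, by
        simpa using (inferInstance : M.Normal).conj_mem m.1 m.2 g⁻¹⟩ g
      rw [show g * (g⁻¹ * (m : G) * g) = m * g by group, hl] at e
      change y (g⁻¹ * m * g) = y m
      linear_combination -e⟩
  let ψ₁ := H1.descend ψ M hM inf_le_left
  let ψ₂ := H1.descend ψ' M hM inf_le_right
  have hN : IsDistinguished q ((H1.ker φ.1).map M.subtype) := by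
    refine ⟨M, inferInstance, hM, φ, simpleElement ψ₁ ψ₂, ⟨ψ₁, ψ₂, rfl, ?_⟩, ?_, rfl⟩
    · refine le_antisymm bot_le fun a ha => ?_
      induction a using QuotientGroup.induction_on with
      | H a => exact (QuotientGroup.eq_one_iff a).mpr ha
    · rw [Lambda_simpleElement, eq_comm, trg_eq_iff]
      refine ⟨y, simpleCocycle ψ₁ ψ₂, hy, fun m => rfl, fun g h => ?_, rfl⟩
      rw [simpleCocycle_apply, H1.descend_mk, H1.descend_mk, H1.descend_mk]
      exact hc g h
  obtain ⟨m, hm, rfl⟩ := Subgroup.mem_sInf.mp hx _ hN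
  exact ⟨m.2.1, y, hy, hcy, hm⟩

variable {x : G}

/-- Every `ψ` is the first entry of a simple element killed by `Λ`: pair it with `0` if `q = 2`,
with `ξ` otherwise. The distinguished subgroup obtained lies in `Ker ψ`. -/
theorem H1.eq_zero_of_mem_Delta (hβ : ∃ ξ : H1 G q, ∀ ψ : H1 G q, cup ψ ξ + bockstein ψ = 0)
    (hx : x ∈ Delta G q) (ψ : H1 G q) : ψ.1 x = 0 := by
  obtain ⟨ξ, hξ⟩ := hβ
  by_cases hq : q = 2
  · refine (mem_primitiveVanishingAt_of_mem_Delta hx ψ 0 ?_).1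
    unfold simpleCocycle
    rw [if_pos hq]
    exact map_zero (cup ψ)
  · refine (mem_primitiveVanishingAt_of_mem_Delta hx ψ ξ ?_).1
    unfold simpleCocycle
    rw [if_neg hq]
    exact hξ ψ

/-- For `q ≠ 2` a simple element also carries the Bockstein of `ψ`. Both pairs `(ψ, ψ' + ξ)` and
`(ψ, ξ)` are killed by `Λ`, and the Bocksteins cancel in the difference of their cocycles. -/
theorem cupCocycle_mem_primitiveVanishingAt
    (hβ : ∃ ξ : H1 G q, ∀ ψ : H1 G q, cup ψ ξ + bockstein ψ = 0)
    (hx : x ∈ Delta G q) {ψ ψ' : H1 G q} (h : cup ψ ψ' = 0) :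
    cupCocycle ψ ψ' ∈ primitiveVanishingAt q x := by
  obtain ⟨ξ, hξ⟩ := hβ
  by_cases hq : q = 2
  · have := (mem_primitiveVanishingAt_of_mem_Delta hx ψ ψ' (by
      unfold simpleCocycle
      rw [if_pos hq]
      exact h)).2
    rwa [simpleCocycle, if_pos hq] at this
  · have h1 := (mem_primitiveVanishingAt_of_mem_Delta hx ψ ξ (by
      unfold simpleCocycle
      rw [if_neg hq]
      exact hξ ψ)).2
    have h2 := (mem_primitiveVanishingAt_of_mem_Delta hx ψ (ψ' + ξ) (by
      unfold simpleCocycle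
      rw [if_neg hq, H2.mk_add]
      change cup ψ (ψ' + ξ) + bockstein ψ = 0
      rw [map_add, h, zero_add, hξ])).2
    rw [simpleCocycle, if_neg hq] at h1 h2
    convert sub_mem h2 h1 using 1
    rw [add_sub_add_right_eq_sub, ← cupCocycleTensor_tmul, ← cupCocycleTensor_tmul,
      ← cupCocycleTensor_tmul, ← map_sub, ← TensorProduct.tmul_sub, add_sub_cancel_right]

/-- For `q ≠ 2`, the relation `ψ ∪ ξ + β(ψ) = 0` is itself of simple type, so trading `β(ψ)` for `-ψ
∪ ξ` costs only a cocycle with a primitive vanishing at `x`. -/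
theorem bocksteinCocycle_mem_range_sup
    (hβ : ∃ ξ : H1 G q, ∀ ψ : H1 G q, cup ψ ξ + bockstein ψ = 0)
    (hx : x ∈ Delta G q) (ψ : H1 G q) :
    bocksteinCocycle ψ ∈ (cupCocycleTensor G q).range ⊔ primitiveVanishingAt q x := by
  obtain ⟨ξ, hξ⟩ := hβ
  by_cases hq : q = 2
  · exact AddSubgroup.mem_sup_left
      ⟨ψ ⊗ₜ ψ, (bocksteinCocycle_eq_cupCocycle_of_eq_two hq ψ).symm⟩
  · have h1 := (mem_primitiveVanishingAt_of_mem_Delta hx ψ ξ (by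
      unfold simpleCocycle
      rw [if_neg hq]
      exact hξ ψ)).2
    rw [simpleCocycle, if_neg hq] at h1
    rw [← neg_add_cancel_left (cupCocycle ψ ξ) (bocksteinCocycle ψ)]
    exact add_mem (neg_mem (AddSubgroup.mem_sup_left ⟨ψ ⊗ₜ ξ, rfl⟩))
      (AddSubgroup.mem_sup_right h1)

/-- A combination of cup products and Bocksteins whose class vanishes has primitives vanishing on
`Δ_G`. -/
theorem mem_primitiveVanishingAt_of_mk_eq_zero
    (hker : (cupTensor G q).ker = AddSubgroup.closure
      {t | t ∈ (cupTensor G q).ker ∧ ∃ ψ ψ' : H1 G q, t = ψ ⊗ₜ[ℤ] ψ'})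
    (hβ : ∃ ξ : H1 G q, ∀ ψ : H1 G q, cup ψ ξ + bockstein ψ = 0)
    (hx : x ∈ Delta G q) {c : Z2 G q}
    (hc : c ∈ (cupCocycleTensor G q).range ⊔ primitiveVanishingAt q x) (h0 : H2.mk c = 0) :
    c ∈ primitiveVanishingAt q x := by
  obtain ⟨_, ⟨t, rfl⟩, w, hw, rfl⟩ := AddSubgroup.mem_sup.mp hc
  refine add_mem ?_ hw
  rw [H2.mk_add, mk_eq_zero_of_mem_primitiveVanishingAt hw, add_zero, mk_cupCocycleTensor] at h0
  have ht : t ∈ (cupTensor G q).ker := h0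
  rw [hker] at ht
  have hle : AddSubgroup.closure
      {t | t ∈ (cupTensor G q).ker ∧ ∃ ψ ψ' : H1 G q, t = ψ ⊗ₜ[ℤ] ψ'} ≤
      (primitiveVanishingAt q x).comap (cupCocycleTensor G q) := by
    rw [AddSubgroup.closure_le]
    rintro _ ⟨h, ψ, ψ', rfl⟩
    exact cupCocycle_mem_primitiveVanishingAt hβ hx h
  exact hle ht

end Primitives

/-! ### Invariant homomorphisms vanish on `Δ_G`. -/

section Main

variable {G : Type u} [Group G] [TopologicalSpace G]

/-- The cocycle `∑ aᵢⱼ (χᵢ ∪ χⱼ) + ∑ bᵢ β(χᵢ)`. -/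
noncomputable def coordinateCocycle {q : ℕ} [NeZero q] {ι : Type*} [Fintype ι] (χ : ι → H1 G q)
    (a : ι → ι → ZMod q) (b : ι → ZMod q) : Z2 G q :=
  ∑ i, ∑ j, (a i j).val • cupCocycle (χ i) (χ j) + ∑ i, (b i).val • bocksteinCocycle (χ i)

theorem coordinateCocycle_apply {q : ℕ} [NeZero q] {ι : Type*} [Fintype ι] (χ : ι → H1 G q)
    (a : ι → ι → ZMod q) (b : ι → ZMod q) (g h : G) :
    (coordinateCocycle χ a b).1 (g, h) = ∑ i, ∑ j, a i j * ((χ i).1 g * (χ j).1 h) +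
      ∑ i, b i * (zmodCarry ((χ i).1 g) ((χ i).1 h) : ZMod q) := by
  have key : ∀ (c : ZMod q) (f : Z2 G q), (c.val • f : Z2 G q).1 (g, h) = c * f.1 (g, h) := by
    intro c f
    rw [AddSubgroup.coe_nsmul, Pi.smul_apply, _root_.nsmul_eq_mul, ZMod.natCast_zmod_val]
  simp only [coordinateCocycle, AddSubgroup.coe_add, AddSubgroup.val_finsetSum, Pi.add_apply,
    Finset.sum_apply, key, bocksteinCocycle_apply]
  rfl

theorem isLocallyConstant_comp_coordinates {q : ℕ} {ι : Type*} [Finite ι] (χ : ι → H1 G q)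
    {A : Type*} (z : (ι → ZMod q) → A) : IsLocallyConstant fun g => z fun i => (χ i).1 g := by
  rw [IsLocallyConstant.iff_eventually_eq]
  intro g
  have : ∀ i, ∀ᶠ h in nhds g, (χ i).1 h = (χ i).1 g := fun i =>
    (IsLocallyConstant.iff_eventually_eq _).mp (χ i).2.1 g
  filter_upwards [Filter.eventually_all.mpr this] with h hh
  simp only [hh]

variable [IsTopologicalGroup G]

theorem coordinateCocycle_mem {q : ℕ} [NeZero q] {ι : Type*} [Fintype ι] (χ : ι → H1 G q)
    (a : ι → ι → ZMod q) (b : ι → ZMod q) {x : G}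
    (hβ : ∃ ξ : H1 G q, ∀ ψ : H1 G q, cup ψ ξ + bockstein ψ = 0) (hx : x ∈ Delta G q) :
    coordinateCocycle χ a b ∈ (cupCocycleTensor G q).range ⊔ primitiveVanishingAt q x :=
  add_mem
    (sum_mem fun i _ => sum_mem fun j _ => nsmul_mem
      (AddSubgroup.mem_sup_left (AddMonoidHom.mem_range.mpr ⟨χ i ⊗ₜ χ j, rfl⟩)) _)
    (sum_mem fun i _ => nsmul_mem (bocksteinCocycle_mem_range_sup hβ hx (χ i)) _)

variable [CompactSpace G]

/-- Invariant homomorphisms on open normal subgroups with abelian quotient of exponent dividing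
`p^d` vanish on `Δ_G`. -/
theorem H1Inv.eq_zero_of_mem_Delta {p d : ℕ} [Fact p.Prime] (hG : GaloisRelationType G p d)
    {M : Subgroup G} [M.Normal] (hM : IsOpen (M : Set G)) (hpow : ∀ g : G, g ^ p ^ d ∈ M)
    (hab : ∀ g h : G, h⁻¹ * g⁻¹ * h * g ∈ M) (φ : H1Inv M (p ^ d)) {x : G}
    (hx : x ∈ Delta G (p ^ d)) (hxM : x ∈ M) : φ.1.1 ⟨x, hxM⟩ = 0 := by
  have hH1 := H1.eq_zero_of_mem_Delta hG.bockstein_eq hx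
  obtain ⟨ι, _, χ, hker, hsurj⟩ := exists_surjective_coordinates hG.reduce_surjective hM hpow hab
  let _ : LinearOrder ι := IsWellOrder.linearOrder WellOrderingRel
  obtain ⟨_, y, f, hy, hyM, hf, -⟩ := exists_isTransgression M hM φ
  choose σ hσ using hsurj
  -- The choice of `σ` is immaterial modulo `M`, so `π` is a homomorphism through which `G → G/M`
  -- factors; it carries `f` back to `(ℤ/q)^ι`.
  let π : (ι → ZMod (p ^ d)) → G ⧸ M := fun v => (σ v : G ⧸ M)
  have hπ : ∀ g : G, π (fun i => (χ i).1 g) = (g : G ⧸ M) := fun g => by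
    refine QuotientGroup.eq.mpr (hker _ fun i => ?_)
    rw [(χ i).2.2, H1.map_inv, hσ, neg_add_cancel]
  have hπadd : ∀ v w, π (v + w) = π v * π w := fun v w => by
    rw [← QuotientGroup.mk_mul, ← hπ (σ v * σ w)]
    congr 1
    ext i
    rw [(χ i).2.2, hσ, hσ]
    rfl
  have hcoc : IsAddCocycle fun v w => f.1 (π v, π w) := fun u v w => by
    simp only [hπadd]
    exact f.2.2 _ _ _
  obtain ⟨a, b, z, hz⟩ := hcoc.exists_normal_form
  have hc : (coordinateCocycle χ a b).1 = coboundary fun g => y g - z fun i => (χ i).1 g := by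
    funext ⟨g, h⟩
    have e := hz (fun i => (χ i).1 g) (fun i => (χ i).1 h)
    have hgh : ((fun i => (χ i).1 g) + fun i => (χ i).1 h) = fun i => (χ i).1 (g * h) := by
      ext i
      exact ((χ i).2.2 g h).symm
    rw [hgh, ← coordinateCocycle_apply, hπ, hπ, hf] at e
    simp only [coboundary] at e ⊢
    linear_combination -e
  have hloc := hy.sub (isLocallyConstant_comp_coordinates χ z)
  have h0 := eq_zero_of_mem_primitiveVanishingAt hH1
    (mem_primitiveVanishingAt_of_mk_eq_zero hG.ker_cup hG.bockstein_eq hx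
      (coordinateCocycle_mem χ a b hG.bockstein_eq hx)
      ((H2.mk_eq_zero_iff _).mpr ⟨_, hloc, hc⟩)) hloc hc
  -- Here `h0` only gives `y x = z 0`; evaluating the coboundary at `(1, 1)` gives `z 0 = y 1 = 0`.
  have h1 := congrFun hc (1, 1)
  have hy1 : y 1 = 0 := (hyM 1).trans (H1.map_one φ.1)
  simp only [coordinateCocycle_apply, coboundary, H1.map_one, zmodCarry_zero_left, mul_zero,
    Int.cast_zero, Finset.sum_const_zero, mul_one, hy1] at h1
  simp only [Pi.sub_apply, hH1] at h0
  rw [← hyM ⟨x, hxM⟩]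
  linear_combination h0 + h1

end Main

/-! ### The central series and the two inclusions. -/

section CentralSeries

/-- The subgroup of central elements killed by `q`. -/
def centerTorsion (Q : Type*) [Group Q] (q : ℕ) : Subgroup Q where
  carrier := {a | a ∈ Subgroup.center Q ∧ a ^ q = 1}
  one_mem' := ⟨one_mem _, one_pow _⟩
  mul_mem' := by
    rintro a b ⟨ha, haq⟩ ⟨hb, hbq⟩
    refine ⟨mul_mem ha hb, ?_⟩
    rw [Commute.mul_pow (Subgroup.mem_center_iff.mp hb a), haq, hbq, one_mul]
  inv_mem' := by
    rintro a ⟨ha, haq⟩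
    exact ⟨inv_mem ha, by rw [inv_pow, haq, inv_one]⟩

theorem exists_character_of_mem_centerTorsion {Q : Type*} [Group Q] [Finite Q] {q : ℕ} [NeZero q]
    {x : Q} (hx : x ∈ centerTorsion Q q) (hx1 : x ≠ 1) :
    ∃ F : Q → ZMod q, (∀ a ∈ centerTorsion Q q, ∀ b ∈ centerTorsion Q q,
      F (a * b) = F a + F b) ∧ F x ≠ 0 := by
  classical
  let _ : CommGroup (centerTorsion Q q) :=
    { (inferInstance : Group (centerTorsion Q q)) with
      mul_comm := fun a b => Subtype.ext (Subgroup.mem_center_iff.mp b.2.1 a) }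
  obtain ⟨f, hf, hfx⟩ := exists_zmod_character_ne_zero (A := centerTorsion Q q) (q := q)
    (a := ⟨x, hx⟩) (fun a => Subtype.ext a.2.2) (fun h => hx1 (congrArg Subtype.val h))
  refine ⟨fun a => if h : a ∈ centerTorsion Q q then f ⟨a, h⟩ else 0,
    fun a ha b hb => ?_, by simpa [hx] using hfx⟩
  simp only [ha, hb, mul_mem ha hb, dite_true]
  exact hf ⟨a, ha⟩ ⟨b, hb⟩

variable {G : Type u} [Group G] [TopologicalSpace G] [IsTopologicalGroup G]

theorem pow_mem_centralSeries {q i : ℕ} {h : G} (hh : h ∈ centralSeries G q (i + 1)) :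
    h ^ q ∈ centralSeries G q (i + 2) :=
  Subgroup.le_topologicalClosure _ (Subgroup.subset_closure (Or.inl ⟨h, hh, rfl⟩))

theorem comm_mem_centralSeries {q i : ℕ} {h : G} (hh : h ∈ centralSeries G q (i + 1)) (g : G) :
    h⁻¹ * g⁻¹ * h * g ∈ centralSeries G q (i + 2) :=
  Subgroup.le_topologicalClosure _ (Subgroup.subset_closure (Or.inr ⟨h, hh, g, rfl⟩))

theorem isClosed_centralSeries (q i : ℕ) : IsClosed (centralSeries G q (i + 2) : Set G) :=
  Subgroup.isClosed_topologicalClosure _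

theorem centralSeries_le {q i : ℕ} {N : Subgroup G} (hN : IsClosed (N : Set G))
    (hpow : ∀ h ∈ centralSeries G q (i + 1), h ^ q ∈ N)
    (hcomm : ∀ h ∈ centralSeries G q (i + 1), ∀ g : G, h⁻¹ * g⁻¹ * h * g ∈ N) :
    centralSeries G q (i + 2) ≤ N := by
  refine Subgroup.topologicalClosure_minimal _ ?_ hN
  rw [Subgroup.closure_le]
  rintro _ (⟨h, hh, rfl⟩ | ⟨h, hh, g, rfl⟩)
  · exact hpow h hh
  · exact hcomm h hh g

theorem centralSeries_normal (q i : ℕ) : (centralSeries G q (i + 1)).Normal := by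
  induction i with
  | zero => exact (inferInstance : (⊤ : Subgroup G).Normal)
  | succ i ih =>
    refine ⟨fun n hn g => ?_⟩
    have hle : centralSeries G q (i + 2) ≤
        (centralSeries G q (i + 2)).comap (MulAut.conj g).toMonoidHom := by
      refine centralSeries_le ?_ (fun h hh => ?_) (fun h hh k => ?_)
      · exact (isClosed_centralSeries q i).preimage
          (f := fun x => g * x * g⁻¹) (by fun_prop)
      · change g * h ^ q * g⁻¹ ∈ centralSeries G q (i + 2)
        rw [← conj_pow]
        exact pow_mem_centralSeries (ih.conj_mem h hh g)
      · change g * (h⁻¹ * k⁻¹ * h * k) * g⁻¹ ∈ centralSeries G q (i + 2)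
        have := comm_mem_centralSeries (ih.conj_mem h hh g) (g * k * g⁻¹)
        convert this using 1
        group
    exact hle hn

/-- In a profinite group, a closed normal subgroup is an intersection of open normal subgroups. -/
theorem exists_open_normal_of_notMem [CompactSpace G] [TotallyDisconnectedSpace G] [T2Space G]
    {N : Subgroup G} [N.Normal] (hN : IsClosed (N : Set G)) {x : G} (hx : x ∉ N) :
    ∃ K : Subgroup G, K.Normal ∧ IsOpen (K : Set G) ∧ N ≤ K ∧ x ∉ K := by
  -- This neighbourhood of `1` consists of the `u` with `x ∉ N u`; an open normal `U` inside it
  -- gives `x ∉ N U`.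
  have hW : IsOpen ((fun u => x * u⁻¹) ⁻¹' (N : Set G)ᶜ) :=
    hN.isOpen_compl.preimage (by fun_prop)
  obtain ⟨U, hU⟩ := ProfiniteGrp.exist_openNormalSubgroup_sub_open_nhds_of_one hW (by simpa using hx)
  refine ⟨N ⊔ U.toSubgroup, inferInstance,
    Subgroup.isOpen_mono le_sup_right U.toOpenSubgroup.isOpen, le_sup_left, fun h => ?_⟩
  obtain ⟨n, hn, u, hu, rfl⟩ := Subgroup.mem_sup_of_normal_right.mp h
  exact hU hu (by simpa using hn)

theorem Delta_le_centralSeries [CompactSpace G] [TotallyDisconnectedSpace G] [T2Space G]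
    {p d : ℕ} [Fact p.Prime] (hG : GaloisRelationType G p d) :
    Delta G (p ^ d) ≤ centralSeries G (p ^ d) 3 := by
  intro x hx
  by_contra hx3
  have := centralSeries_normal (G := G) (p ^ d) 2
  obtain ⟨K, hK, hKo, hle, hxK⟩ := exists_open_normal_of_notMem (isClosed_centralSeries _ 1) hx3
  have : DiscreteTopology (G ⧸ K) := QuotientGroup.discreteTopology hKo
  have : Finite (G ⧸ K) := Subgroup.quotient_finite_of_isOpen K hKo
  -- Conjugation by `G` is trivial on `M/K`, so every character of `M/K` is invariant; and `M/K` has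
  -- exponent dividing `q`, so its characters to `ℤ/q` separate `x` from `1`.
  let M : Subgroup G := (centerTorsion (G ⧸ K) (p ^ d)).comap (QuotientGroup.mk' K)
  have hmem : ∀ g : G, g ∈ M ↔
      (g : G ⧸ K) ∈ Subgroup.center (G ⧸ K) ∧ (g : G ⧸ K) ^ p ^ d = 1 := fun g => Iff.rfl
  have hMcomm : ∀ m ∈ M, ∀ g : G, ((g⁻¹ * m * g : G) : G ⧸ K) = m := by
    intro m hm g
    rw [mul_assoc, QuotientGroup.mk_mul, QuotientGroup.mk_mul,
      ← Subgroup.mem_center_iff.mp ((hmem m).mp hm).1 g, ← mul_assoc, ← QuotientGroup.mk_mul,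
      inv_mul_cancel, QuotientGroup.mk_one, one_mul]
  have hMn : M.Normal := ⟨fun m hm g => by
    have h := hMcomm m hm g⁻¹
    rw [inv_inv] at h
    rw [hmem, h, ← hmem]
    exact hm⟩
  have hKM : K ≤ M := fun k hk => by
    rw [hmem, (QuotientGroup.eq_one_iff k).mpr hk]
    exact ⟨one_mem _, one_pow _⟩
  have hMo : IsOpen (M : Set G) := Subgroup.isOpen_mono hKM hKo
  have h2M : centralSeries G (p ^ d) 2 ≤ M := fun h hh => by
    rw [hmem]
    refine ⟨Subgroup.mem_center_iff.mpr fun g => ?_, ?_⟩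
    · induction g using QuotientGroup.induction_on with
      | H g =>
        rw [← QuotientGroup.mk_mul, ← QuotientGroup.mk_mul, QuotientGroup.eq]
        simpa [mul_assoc] using hle (comm_mem_centralSeries hh g)
    · rw [← QuotientGroup.mk_pow, QuotientGroup.eq_one_iff]
      exact hle (pow_mem_centralSeries hh)
  have hpow : ∀ g : G, g ^ p ^ d ∈ M := fun g =>
    h2M (pow_mem_centralSeries (i := 0) (Subgroup.mem_top g))
  have hab : ∀ g h : G, h⁻¹ * g⁻¹ * h * g ∈ M := fun g h =>
    h2M (comm_mem_centralSeries (i := 0) (Subgroup.mem_top h) g)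
  have hxM : x ∈ M :=
    mem_of_forall_H1_eq_zero hMo hpow hab (H1.eq_zero_of_mem_Delta hG.bockstein_eq hx)
  obtain ⟨F, hF, hFx⟩ := exists_character_of_mem_centerTorsion ((hmem x).mp hxM)
    (fun h => hxK ((QuotientGroup.eq_one_iff x).mp h))
  let φ : H1Inv M (p ^ d) := ⟨⟨fun m => F ((m : G) : G ⧸ K),
    (IsLocallyConstant.of_discrete F).comp_continuous
      (QuotientGroup.continuous_mk.comp continuous_subtype_val),
    fun a b => hF _ ((hmem a).mp a.2) _ ((hmem b).mp b.2)⟩, fun g m => congrArg F (hMcomm m m.2 g)⟩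
  exact hFx (H1Inv.eq_zero_of_mem_Delta hG hMo hpow hab φ hx hxM)

theorem centralSeries_le_Delta {q : ℕ} [NeZero q] : centralSeries G q 3 ≤ Delta G q := by
  refine le_sInf ?_
  rintro _ ⟨M, hMn, hM, φ, α, ⟨ψ, ψ', -, hbot⟩, -, rfl⟩
  have h2M : centralSeries G q 2 ≤ M := by
    refine centralSeries_le (Subgroup.isClosed_of_isOpen M hM) (fun h _ => ?_) (fun h _ g => ?_)
    · rw [← QuotientGroup.eq_one_iff, ← Subgroup.mem_bot, hbot]
      constructor
      · change ψ.1 ((h : G ⧸ M) ^ q) = 0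
        rw [H1.map_pow, ZMod.natCast_self, zero_mul]
      · change ψ'.1 ((h : G ⧸ M) ^ q) = 0
        rw [H1.map_pow, ZMod.natCast_self, zero_mul]
    · rw [← QuotientGroup.eq_one_iff, ← Subgroup.mem_bot, hbot]
      exact ⟨H1.map_comm ψ (g : G ⧸ M) h, H1.map_comm ψ' (g : G ⧸ M) h⟩
  have hN : IsOpen ((H1.ker φ.1).map M.subtype : Set G) :=
    hM.isOpenMap_subtype_val _ (H1.isOpen_ker φ.1)
  refine centralSeries_le (Subgroup.isClosed_of_isOpen _ hN) (fun h hh => ?_) (fun h hh g => ?_)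
  · refine ⟨⟨h, h2M hh⟩ ^ q, ?_, rfl⟩
    change φ.1.1 (_ ^ q) = 0
    rw [H1.map_pow, ZMod.natCast_self, zero_mul]
  · have hc : g⁻¹ * h * g ∈ M := by simpa using hMn.conj_mem h (h2M hh) g⁻¹
    -- Grouping `[h, g]` as `h⁻¹ · (g⁻¹ h g)` puts both factors in `M`, where invariance of `φ`
    -- makes their values cancel.
    refine ⟨⟨h, h2M hh⟩⁻¹ * ⟨g⁻¹ * h * g, hc⟩, ?_, by simp [mul_assoc]⟩
    change φ.1.1 _ = 0
    rw [φ.1.2.2, H1.map_inv, φ.2 g ⟨h, h2M hh⟩, neg_add_cancel]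

end CentralSeries

end QCentral

theorem theorem5p2 {G : Type*} [Group G] [TopologicalSpace G] [IsTopologicalGroup G]
    [CompactSpace G] [T2Space G] [TotallyDisconnectedSpace G]
    (p d : ℕ) [Fact p.Prime] (hG : QCentral.GaloisRelationType G p d) :
    QCentral.centralSeries G (p ^ d) 3 = QCentral.Delta G (p ^ d) :=
  le_antisymm QCentral.centralSeries_le_Delta (QCentral.Delta_le_centralSeries hG)
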